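/- **Corollary.** Let $b>0$ and $0<\rho<1$ be fixed, let $(X,Y)$ be jointly Gaussian with mean $0$, $\operatorname{Var}X=\operatorname{Var}Y=1$ and $\operatorname{Cov}(X,Y)=\rho$, and for $a\in(0,b)$ let $T=T_a=aX+bY$. All logarithms are natural, $p$ denotes Lebesgue densities, and $I(\cdot\,;\cdot)$ is mutual information, i.e. the Kullback–Leibler divergence of the joint law from the product of the marginals (with values in $[0,\infty]$). For a redundancy value $R$, the other atoms $U_X,U_Y,S$ of the partial information decomposition are determined by $$I(T;X)=R+U_X,\qquad I(T;Y)=R+U_Y,\qquad I(T;X,Y)=R+U_X+U_Y+S .$$ Two redundancies are considered: - $R^{\min}=\mathbb E\big[\min(I_X(T),I_Y(T))\big]$, where $I_X(t)=D_{\mathrm{KL}}(P_{X\mid T=t}\,\|\,P_X)$ and $I_Y(t)=D_{\mathrm{KL}}(P_{Y\mid T=t}\,\|\,P_Y)$ are the specific informations; - $R^{PM}=\mathbb E\Big[\min\Big(\log\tfrac1{p_X(X)},\log\tfrac1{p_Y(Y)}\Big)\Big]-\mathbb E\Big[\min\Big(\log\tfrac1{p_{X\mid T}(X\mid T)},\log\tfrac1{p_{Y\mid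 T}(Y\mid T)}\Big)\Big]$. The atoms of the corresponding decompositions carry the superscripts $\min$ and $PM$. Then, as $a\to0^+$, $$R^{\min}\to I(X;Y)=-\log\sqrt{1-\rho^2},\qquad U_X^{\min}=0,\qquad U_Y^{\min}\to\infty,\qquad S^{\min}=\infty,$$ $$R^{PM}\to\infty,\qquad U_X^{PM}\to-\infty,\qquad U_Y^{PM}=\tfrac1\pi\sqrt{1-\rho^2},\qquad S^{PM}=\infty,$$ where each equality for an atom holds for every $a\in(0,b)$. Moreover $$\frac{U_Y^{\min}}{I(T;Y)}\to1,\quad \frac{R^{\min}}{I(T;Y)}\to0,\quad \frac{U_X^{PM}}{I(T;Y)}\to-1,\quad \frac{U_X^{PM}}{R^{PM}}\to-1,\quad \frac{R^{PM}}{I(T;Y)}\to1,$$ $$\frac{U_X^{PM}}{U_Y^{\min}}\to-1,\qquad \frac{U_Y^{\min}}{R^{PM}}\to1 .$$ -/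

import Mathlib

open MeasureTheory ProbabilityTheory InformationTheory Filter Topology
open scoped ENNReal

noncomputable section

namespace PID

variable {Ω : Type*} [MeasurableSpace Ω]

/-- Mutual information (in nats) `I(U;V) = D_KL(P_{(U,V)} ‖ P_U ⊗ P_V)`; it is `∞` when the joint
law is not absolutely continuous with respect to the product of the marginals. -/
def mutualInfo {α β : Type*} [MeasurableSpace α] [MeasurableSpace β]
    (P : Measure Ω) (U : Ω → α) (V : Ω → β) : EReal :=
  ((klDiv (P.map fun ω => (U ω, V ω)) ((P.map U).prod (P.map V)) : ℝ≥0∞) : EReal)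

/-- Expectation of an extended-real valued random variable, `E[f⁺] - E[f⁻]`. It takes a finite value
only if both parts are finite (the indeterminate `∞ - ∞` is `-∞` in `EReal`). -/
def extExpectation (P : Measure Ω) (f : Ω → EReal) : EReal :=
  ((∫⁻ ω, (f ω).toENNReal ∂P : ℝ≥0∞) : EReal) - ((∫⁻ ω, (-f ω).toENNReal ∂P : ℝ≥0∞) : EReal)

/-- Specific information that `X` carries about the outcome `T = t`:
`I_X(t) = D_KL(P_{X|T=t} ‖ P_X) = E[log (p_{X,T}(X,T) / (p_X(X) p_T(T))) | T = t]`. -/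
def specificInfo (P : Measure Ω) [IsFiniteMeasure P] (T X : Ω → ℝ) (t : ℝ) : ℝ≥0∞ :=
  klDiv (condDistrib X T P t) (P.map X)

/-- The redundancy `I_∩^min(T;X,Y) = E[min(I_X(T), I_Y(T))]`. -/
def minRedundancy (P : Measure Ω) [IsFiniteMeasure P] (T X Y : Ω → ℝ) : EReal :=
  ((∫⁻ ω, min (specificInfo P T X (T ω)) (specificInfo P T Y (T ω)) ∂P : ℝ≥0∞) : EReal)

/-- The pointwise information content `-log p_X(X)`, with `p_X` the Lebesgue density of `X`. -/
def infoContent (P : Measure Ω) (X : Ω → ℝ) (ω : Ω) : EReal :=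
  -ENNReal.log (pdf X P volume (X ω))

/-- The pointwise conditional information content `-log p_{X|T}(X|T)`, where
`p_{X|T} = p_{X,T} / p_T` is formed from Lebesgue densities. -/
def condInfoContent (P : Measure Ω) (T X : Ω → ℝ) (ω : Ω) : EReal :=
  -ENNReal.log (pdf (fun ω' => (X ω', T ω')) P volume (X ω, T ω) / pdf T P volume (T ω))

/-- Redundant specificity `I_∩^{PM,+}(T;X,Y) = E[min(-log p_X(X), -log p_Y(Y))]`. -/
def pmSpecificity (P : Measure Ω) (X Y : Ω → ℝ) : EReal :=
  extExpectation P fun ω => min (infoContent P X ω) (infoContent P Y ω)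

/-- Redundant ambiguity
`I_∩^{PM,-}(T;X,Y) = E[min(-log p_{X|T}(X|T), -log p_{Y|T}(Y|T))]`. -/
def pmAmbiguity (P : Measure Ω) (T X Y : Ω → ℝ) : EReal :=
  extExpectation P fun ω => min (condInfoContent P T X ω) (condInfoContent P T Y ω)

/-- The redundancy `I_∩^PM = I_∩^{PM,+} - I_∩^{PM,-}`. -/
def pmRedundancy (P : Measure Ω) (T X Y : Ω → ℝ) : EReal :=
  pmSpecificity P X Y - pmAmbiguity P T X Y

/-- The four atoms of a bivariate partial information decomposition. -/
structure Atoms where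
  /-- The redundant information `R`. -/
  R : EReal
  /-- The information `U_X` unique to the first predictor. -/
  UX : EReal
  /-- The information `U_Y` unique to the second predictor. -/
  UY : EReal
  /-- The synergistic information `S`. -/
  S : EReal

/-- The decomposition that a redundancy value `R` determines through
`I(T;X) = R + U_X`, `I(T;Y) = R + U_Y` and `I(T;X,Y) = R + U_X + U_Y + S`. -/
def decomposition (P : Measure Ω) (T X Y : Ω → ℝ) (R : EReal) : Atoms where
  R := R
  UX := mutualInfo P T X - R
  UY := mutualInfo P T Y - R
  S := mutualInfo P T (fun ω => (X ω, Y ω)) - R - (mutualInfo P T X - R) - (mutualInfo P T Y - R)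

/-- The decomposition based on `I_∩^min`. -/
def dMin (P : Measure Ω) [IsFiniteMeasure P] (T X Y : Ω → ℝ) : Atoms :=
  decomposition P T X Y (minRedundancy P T X Y)

/-- The decomposition based on `I_∩^PM`. -/
def dPM (P : Measure Ω) (T X Y : Ω → ℝ) : Atoms :=
  decomposition P T X Y (pmRedundancy P T X Y)

/-- `(X, Y)` is a centred Gaussian vector with covariance matrix `(1, ρ; ρ, 1)`. -/
structure IsNormalizedGaussianPair (P : Measure Ω) (X Y : Ω → ℝ) (ρ : ℝ) : Prop where
  measurable_fst : Measurable X
  measurable_snd : Measurable Y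
  hasGaussianLaw : HasGaussianLaw (fun ω => (X ω, Y ω)) P
  mean_fst : ∫ ω, X ω ∂P = 0
  mean_snd : ∫ ω, Y ω ∂P = 0
  variance_fst : variance X P = 1
  variance_snd : variance Y P = 1
  covariance_eq : covariance X Y P = ρ

end PID

end

/-!
Write `T = aX + bY` with `0 < a < b`. Each of the pairs `(T, X)`, `(T, Y)` is a Gaussian linear
regression: the predictor is `c T + W` with a residual `W ∼ N(0, v)` independent of `T`, because for
jointly Gaussian variables uncorrelated means independent. The conditional law of the predictor
given `T = t` is therefore `N(c t, v)`, and every information quantity becomes an explicit quadratic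
in `T` and `W`; for instance `I(T; X) = -½ log v₁` and `I(T; Y) = -½ log v₂` with the residual
variances `v₁ = b²(1 - ρ²) / Var T` and `v₂ = a²(1 - ρ²) / Var T`.

Since `v₂ < v₁`, both pointwise minima over the two predictors that involve `T` are attained by a
fixed predictor. The specific information `D(N(c t, v) ‖ N(0, 1))` of `Y` is at least that of `X`
for every `t`, hence `R^min = I(T; X)` (`minRedundancy_eq`). The residuals satisfy
`a W₁ + b W₂ = 0`, so that `W₁² / v₁ = W₂² / v₂`; the two conditional information contents differ by a
constant and the redundant ambiguity is the conditional entropy of `Y` given `T` (`pmAmbiguity_eq`).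
The redundant specificity requires `E[min(X², Y²)] = 1 - ½ E|X² - Y²|`, where
`X² - Y² = (X - Y)(X + Y)` is a product of independent Gaussians (`integral_abs_sq_sub_sq`). Together these give
`R^PM = I(T; Y) - √(1 - ρ²) / π`.

The synergies are infinite because `T` is a function of `(X, Y)` without atoms
(`mutualInfo_comp_eq_top`). As `a → 0⁺` the variance `v₂` tends to `0` and `v₁` to `1 - ρ²`, so
every finite atom is `±I(T; Y)` or `0` up to a convergent term, which settles all limits of atoms
and quotients.
-/

namespace PID

/-! ### Divergences, densities and expectations -/

/-- If `μ` has density `exp ℓ` with respect to `ν`, then `ℓ` is the log-likelihood ratio, so the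
divergence is its mean. -/
lemma klDiv_of_eq_withDensity_exp {α : Type*} [MeasurableSpace α] {μ ν : Measure α}
    [IsProbabilityMeasure μ] [IsProbabilityMeasure ν] {l : α → ℝ} (hl : Measurable l)
    (hμ : μ = ν.withDensity fun x => ENNReal.ofReal (Real.exp (l x))) (hint : Integrable l μ) :
    klDiv μ ν = ENNReal.ofReal (∫ x, l x ∂μ) := by
  have hac : μ ≪ ν := hμ ▸ withDensity_absolutelyContinuous _ _
  have h1 : μ.rnDeriv ν =ᵐ[ν] fun x => ENNReal.ofReal (Real.exp (l x)) := by
    conv_lhs => rw [hμ]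
    exact Measure.rnDeriv_withDensity ν (by fun_prop)
  have h2 : llr μ ν =ᵐ[μ] l := by
    filter_upwards [hac.ae_le h1] with x hx
    rw [llr, hx, ENNReal.toReal_ofReal (Real.exp_nonneg _), Real.log_exp]
  rw [klDiv_of_ac_of_integrable hac (hint.congr h2.symm), integral_congr_ae h2]
  simp

lemma compProd_eq_withDensity {α β : Type*} [MeasurableSpace α] [MeasurableSpace β]
    {μ : Measure α} {ν : Measure β} {κ : Kernel α β} [SFinite μ] [SFinite ν] [IsSFiniteKernel κ]
    {D : α → β → ℝ≥0∞} (hD : Measurable (Function.uncurry D))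
    (h : ∀ a, κ a = ν.withDensity (D a)) :
    μ ⊗ₘ κ = (μ.prod ν).withDensity (Function.uncurry D) := by
  refine Measure.ext_of_lintegral _ fun f hf => ?_
  rw [Measure.lintegral_compProd hf, lintegral_withDensity_eq_lintegral_mul _ hD hf,
    lintegral_prod _ (by fun_prop)]
  refine lintegral_congr fun a => ?_
  have hDa : Measurable (D a) := hD.comp measurable_prodMk_left
  rw [h a, lintegral_withDensity_eq_lintegral_mul _ hDa (by fun_prop)]
  rfl

lemma ae_pdf_comp_eq {Ω E : Type*} [MeasurableSpace Ω] [MeasurableSpace E] {P : Measure Ω}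
    {μ : Measure E} [SigmaFinite μ] {Z : Ω → E} (hZ : Measurable Z) {f : E → ℝ≥0∞}
    (hf : Measurable f) (h : P.map Z = μ.withDensity f) :
    ∀ᵐ ω ∂P, pdf Z P μ (Z ω) = f (Z ω) := by
  have h1 : pdf Z P μ =ᵐ[P.map Z] f := by
    have hac : P.map Z ≪ μ := h ▸ withDensity_absolutelyContinuous _ _
    refine hac.ae_le ?_
    rw [pdf_def, h]
    exact Measure.rnDeriv_withDensity μ hf
  exact ae_of_ae_map hZ.aemeasurable h1

lemma extExpectation_coe {Ω : Type*} [MeasurableSpace Ω] {P : Measure Ω} {F : Ω → EReal}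
    {f : Ω → ℝ} (hf : Integrable f P) (h : ∀ᵐ ω ∂P, F ω = f ω) :
    extExpectation P F = ((∫ ω, f ω ∂P : ℝ) : EReal) := by
  have h1 : ∫⁻ ω, (F ω).toENNReal ∂P = ∫⁻ ω, ENNReal.ofReal (f ω) ∂P := by
    refine lintegral_congr_ae ?_
    filter_upwards [h] with ω hω
    rw [hω, EReal.toENNReal_of_ne_top (EReal.coe_ne_top _), EReal.toReal_coe]
  have h2 : ∫⁻ ω, (-F ω).toENNReal ∂P = ∫⁻ ω, ENNReal.ofReal (-f ω) ∂P := by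
    refine lintegral_congr_ae ?_
    filter_upwards [h] with ω hω
    rw [hω, ← EReal.coe_neg, EReal.toENNReal_of_ne_top (EReal.coe_ne_top _), EReal.toReal_coe]
  rw [extExpectation, h1, h2, integral_eq_lintegral_pos_part_sub_lintegral_neg_part hf,
    EReal.coe_sub, EReal.coe_ennreal_toReal, EReal.coe_ennreal_toReal]
  · exact ((hf.neg.lintegral_lt_top)).ne
  · exact hf.lintegral_lt_top.ne

/-- A variable with atomless law that is a function of the observed one shares infinite
information with it: the joint law lives on a graph, which is null for the product law. -/
lemma mutualInfo_comp_eq_top {Ω β : Type*} [MeasurableSpace Ω] [MeasurableSpace β]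
    {P : Measure Ω} [IsProbabilityMeasure P] {T : Ω → ℝ} {Z : Ω → β} {g : β → ℝ}
    (hZ : Measurable Z) (hg : Measurable g) (hT : ∀ ω, T ω = g (Z ω))
    [NullSingletonClass (P.map T)] : mutualInfo P T Z = ⊤ := by
  have hTm : Measurable T := by
    rw [show T = g ∘ Z from funext hT]; exact hg.comp hZ
  have : IsProbabilityMeasure (P.map T) := Measure.isProbabilityMeasure_map hTm.aemeasurable
  have : IsProbabilityMeasure (P.map Z) := Measure.isProbabilityMeasure_map hZ.aemeasurable
  have hs : MeasurableSet {p : ℝ × β | p.1 = g p.2} :=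
    measurableSet_eq_fun measurable_fst (hg.comp measurable_snd)
  rw [mutualInfo, klDiv_of_not_ac, EReal.coe_ennreal_top]
  intro hac
  have h0 : ((P.map T).prod (P.map Z)) {p : ℝ × β | p.1 = g p.2} = 0 := by
    rw [Measure.prod_apply_symm hs]
    simp [Set.preimage]
  have h1 := hac h0
  rw [Measure.map_apply (hTm.prodMk hZ) hs] at h1
  simp [hT] at h1

/-! ### Gaussian measures on the line -/

/-- The conditional law of `c T + W` given `T`, for a residual `W ∼ N(0, v)` independent of `T`:
the Markov kernel `t ↦ N(c t, v)`. -/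
noncomputable def gaussianRegression (c : ℝ) (v : NNReal) : Kernel ℝ ℝ where
  toFun t := gaussianReal (c * t) v
  measurable' := by
    have := measurable_gaussianReal
    fun_prop

instance (c : ℝ) (v : NNReal) : IsMarkovKernel (gaussianRegression c v) :=
  ⟨fun t => inferInstanceAs (IsProbabilityMeasure (gaussianReal (c * t) v))⟩

lemma gaussianRegression_apply (c : ℝ) (v : NNReal) (t : ℝ) :
    gaussianRegression c v t = gaussianReal (c * t) v := rfl

/-- The log-likelihood ratio of `N(m, v)` against `N(0, 1)`, for `v > 0`. -/
noncomputable def gaussianLLR (v m x : ℝ) : ℝ :=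
  -(1 / 2) * Real.log v - (x - m) ^ 2 / (2 * v) + x ^ 2 / 2

lemma log_gaussianPDFReal (m x : ℝ) {v : NNReal} (hv : v ≠ 0) :
    Real.log (gaussianPDFReal m v x)
      = -(1 / 2) * Real.log (2 * Real.pi) - (1 / 2) * Real.log v - (x - m) ^ 2 / (2 * v) := by
  have hv' : (0 : ℝ) < v := by positivity
  rw [gaussianPDFReal_def]
  dsimp only
  rw [Real.log_mul (by positivity) (by positivity), Real.log_exp, Real.log_inv,
    Real.log_sqrt (by positivity), Real.log_mul (by positivity) (by positivity)]
  ring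

lemma gaussianReal_eq_withDensity_gaussianLLR (m : ℝ) {v : NNReal} (hv : v ≠ 0) :
    gaussianReal m v = (gaussianReal 0 1).withDensity
      fun x => ENNReal.ofReal (Real.exp (gaussianLLR v m x)) := by
  have hm : Measurable (fun x => ENNReal.ofReal (Real.exp (gaussianLLR v m x))) := by
    unfold gaussianLLR; fun_prop
  rw [gaussianReal_of_var_ne_zero _ one_ne_zero,
    ← withDensity_mul _ (measurable_gaussianPDF _ _) hm,
    gaussianReal_of_var_ne_zero _ hv]
  congr 1
  ext1 x
  have h0 := gaussianPDFReal_pos m v x hv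
  have h1 := gaussianPDFReal_pos 0 1 x one_ne_zero
  rw [Pi.mul_apply, gaussianPDF, gaussianPDF, ← ENNReal.ofReal_mul h1.le]
  congr 1
  rw [← Real.exp_log h0, ← Real.exp_log h1, ← Real.exp_add, log_gaussianPDFReal _ _ hv,
    log_gaussianPDFReal _ _ one_ne_zero, gaussianLLR]
  congr 1
  simp
  ring

lemma integrable_sq_gaussianReal (m : ℝ) (v : NNReal) (k : ℝ) :
    Integrable (fun x => (x - k) ^ 2) (gaussianReal m v) :=
  ((memLp_id_gaussianReal' (μ := m) (v := v) 2 (by simp)).sub (memLp_const k)).integrable_sq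

lemma integral_sq_gaussianReal (m : ℝ) (v : NNReal) :
    ∫ x, x ^ 2 ∂gaussianReal m v = m ^ 2 + v := by
  have h := variance_eq_sub (memLp_id_gaussianReal' (μ := m) (v := v) 2 (by simp))
  rw [variance_id_gaussianReal] at h
  simp only [id, integral_id_gaussianReal, Pi.pow_apply] at h
  linarith

lemma integral_sub_sq_gaussianReal (m : ℝ) (v : NNReal) :
    ∫ x, (x - m) ^ 2 ∂gaussianReal m v = v := by
  have h := variance_eq_integral (μ := gaussianReal m v) (X := id) aemeasurable_id
  rw [variance_id_gaussianReal] at h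
  simpa using h.symm

lemma klDiv_gaussianReal_standard (m : ℝ) {v : NNReal} (hv : v ≠ 0) :
    klDiv (gaussianReal m v) (gaussianReal 0 1)
      = ENNReal.ofReal ((m ^ 2 + v - 1 - Real.log v) / 2) := by
  have hv' : (v : ℝ) ≠ 0 := by simpa using hv
  have i1 := (integrable_sq_gaussianReal m v m).div_const (2 * v)
  have i2 : Integrable (fun x : ℝ => x ^ 2 / 2) (gaussianReal m v) := by
    simpa using (integrable_sq_gaussianReal m v 0).div_const 2
  have i0 : Integrable (fun _ : ℝ => -(1 / 2) * Real.log v) (gaussianReal m v) :=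
    integrable_const _
  rw [klDiv_of_eq_withDensity_exp (l := gaussianLLR v m) (by unfold gaussianLLR; fun_prop)
    (gaussianReal_eq_withDensity_gaussianLLR m hv) ((i0.sub i1).add i2)]
  congr 1
  unfold gaussianLLR
  have e1 := integral_add (i0.sub i1) i2
  simp only [Pi.sub_apply] at e1
  rw [e1, integral_sub i0 i1, integral_div, integral_div,
    integral_sub_sq_gaussianReal, integral_sq_gaussianReal]
  simp
  field_simp
  ring

lemma integral_abs_gaussianReal (v : NNReal) :
    ∫ x, |x| ∂gaussianReal 0 v = Real.sqrt (2 * v / Real.pi) := by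
  rcases eq_or_ne v 0 with rfl | hv
  · simp
  have hv' : (0 : ℝ) < v := by positivity
  rw [integral_gaussianReal_eq_integral_smul hv]
  have h1 : ∀ x : ℝ, gaussianPDFReal 0 v x • |x| =
      (fun y => (Real.sqrt (2 * Real.pi * v))⁻¹ *
        (y ^ (1 : ℝ) * Real.exp (-(1 / (2 * v)) * y ^ (2 : ℝ)))) |x| := by
    intro x
    simp only [gaussianPDFReal_def, smul_eq_mul, Real.rpow_one, Real.rpow_two, sq_abs, sub_zero]
    rw [show -x ^ 2 / (2 * (v : ℝ)) = -(1 / (2 * v)) * x ^ 2 by ring]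
    ring
  simp_rw [h1]
  rw [integral_comp_abs (f := fun y => (Real.sqrt (2 * Real.pi * v))⁻¹ *
        (y ^ (1 : ℝ) * Real.exp (-(1 / (2 * v)) * y ^ (2 : ℝ)))), integral_const_mul,
    integral_rpow_mul_exp_neg_mul_rpow (by norm_num) (by norm_num) (by positivity)]
  norm_num
  rw [Real.rpow_neg_one]
  have e1 : Real.sqrt v ^ 2 = v := Real.sq_sqrt hv'.le
  have e2 : Real.sqrt 2 ^ 2 = 2 := Real.sq_sqrt (by norm_num)
  field_simp
  rw [e1, e2]
  ring

/-! ### Gaussian linear regression -/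

/-- `X = c T + W` with independent `T ∼ N(0, s)` and residual `W ∼ N(0, v)`, both nondegenerate,
scaled so that `X` is standard normal. -/
structure IsGaussianRegression {Ω : Type*} [MeasurableSpace Ω] (P : Measure Ω) (T X : Ω → ℝ)
    (c : ℝ) (s v : NNReal) : Prop where
  measurable_left : Measurable T
  measurable_right : Measurable X
  left_ne_zero : s ≠ 0
  residual_ne_zero : v ≠ 0
  variance_eq : c ^ 2 * s + v = 1
  map_left : P.map T = gaussianReal 0 s
  map_right : P.map X = gaussianReal 0 1
  map_residual : P.map (fun ω => X ω - c * T ω) = gaussianReal 0 v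
  indep : IndepFun T (fun ω => X ω - c * T ω) P

/-- For a centred Gaussian pair the regression residual is uncorrelated with, hence independent
of, the regressor. -/
lemma isGaussianRegression_of_hasGaussianLaw {Ω : Type*} [MeasurableSpace Ω] {P : Measure Ω}
    [IsProbabilityMeasure P] {T X : Ω → ℝ} (hT : Measurable T) (hX : Measurable X)
    (h : HasGaussianLaw (fun ω => (T ω, X ω)) P) (hT0 : ∫ ω, T ω ∂P = 0) (hX0 : ∫ ω, X ω ∂P = 0)
    {c : ℝ} {s v : NNReal} (hs : s ≠ 0) (hv : v ≠ 0) (hTs : variance T P = s)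
    (hX1 : variance X P = 1) (hc : covariance T X P = c * s) (hcv : c ^ 2 * s + v = 1) :
    IsGaussianRegression P T X c s v := by
  have hTL := h.fst.memLp_two
  have hXL := h.snd.memLp_two
  have hcT : MemLp (fun ω => c * T ω) 2 P := hTL.const_mul c
  have hpair : HasGaussianLaw (fun ω => (T ω, X ω - c * T ω)) P := by
    have := h.map_fun ((ContinuousLinearMap.fst ℝ ℝ ℝ).prod
      (ContinuousLinearMap.snd ℝ ℝ ℝ - c • ContinuousLinearMap.fst ℝ ℝ ℝ))
    simpa using this
  have hW0 : ∫ ω, (X ω - c * T ω) ∂P = 0 := by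
    rw [integral_sub h.snd.integrable (h.fst.integrable.const_mul c), integral_const_mul, hT0, hX0]
    simp
  have hWv : variance (fun ω => X ω - c * T ω) P = v := by
    have := variance_sub hXL hcT
    rw [variance_const_mul, covariance_const_mul_right, hTs, hX1, covariance_comm, hc] at this
    refine (show _ = _ from this).trans ?_
    linarith
  have hcov : covariance T (fun ω => X ω - c * T ω) P = 0 := by
    have := covariance_sub_right hTL hXL hcT
    rw [covariance_const_mul_right, covariance_self hT.aemeasurable, hTs, hc] at this
    refine (show _ = _ from this).trans ?_
    ring
  refine ⟨hT, hX, hs, hv, hcv, ?_, ?_, ?_, hpair.indepFun_of_covariance_eq_zero hcov⟩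
  · rw [h.fst.map_eq_gaussianReal, hT0, hTs, Real.toNNReal_coe]
  · rw [h.snd.map_eq_gaussianReal, hX0, hX1, Real.toNNReal_one]
  · rw [hpair.snd.map_eq_gaussianReal, hW0, hWv, Real.toNNReal_coe]

namespace IsGaussianRegression

variable {Ω : Type*} [MeasurableSpace Ω] {P : Measure Ω} {T X : Ω → ℝ} {c : ℝ}
  {s v : NNReal}

lemma integrable_sq_right (h : IsGaussianRegression P T X c s v) :
    Integrable (fun ω => X ω ^ 2) P := by
  have := integrable_sq_gaussianReal 0 1 0
  rw [← h.map_right] at this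
  simpa using! (integrable_map_measure (by fun_prop) h.measurable_right.aemeasurable).mp this

lemma integral_sq_right (h : IsGaussianRegression P T X c s v) :
    ∫ ω, X ω ^ 2 ∂P = 1 := by
  have := integral_sq_gaussianReal 0 1
  rw [← h.map_right, integral_map h.measurable_right.aemeasurable (by fun_prop)] at this
  simpa using this

lemma integrable_sq_residual (h : IsGaussianRegression P T X c s v) :
    Integrable (fun ω => (X ω - c * T ω) ^ 2) P := by
  have hT := h.measurable_left
  have hX := h.measurable_right
  have := integrable_sq_gaussianReal 0 v 0
  rw [← h.map_residual] at this
  simpa using! (integrable_map_measure (by fun_prop) (by fun_prop)).mp this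

lemma integral_sq_residual (h : IsGaussianRegression P T X c s v) :
    ∫ ω, (X ω - c * T ω) ^ 2 ∂P = v := by
  have hT := h.measurable_left
  have hX := h.measurable_right
  have := integral_sq_gaussianReal 0 v
  rw [← h.map_residual, integral_map (by fun_prop) (by fun_prop)] at this
  simpa using this

lemma infoContent_ae_eq (h : IsGaussianRegression P T X c s v) :
    ∀ᵐ ω ∂P, infoContent P X ω
      = ((X ω ^ 2 / 2 + (1 / 2) * Real.log (2 * Real.pi) : ℝ) : EReal) := by
  have h1 := ae_pdf_comp_eq h.measurable_right (measurable_gaussianPDF 0 1)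
    (by rw [h.map_right, gaussianReal_of_var_ne_zero _ one_ne_zero])
  filter_upwards [h1] with ω hω
  rw [infoContent, hω, gaussianPDF, ENNReal.log_ofReal_of_pos
    (gaussianPDFReal_pos _ _ _ one_ne_zero), log_gaussianPDFReal _ _ one_ne_zero, ← EReal.coe_neg]
  congr 1
  simp

variable [IsProbabilityMeasure P]

lemma map_prodMk (h : IsGaussianRegression P T X c s v) :
    P.map (fun ω => (T ω, X ω)) = P.map T ⊗ₘ gaussianRegression c v := by
  have hT := h.measurable_left
  have hX := h.measurable_right
  have hφ : Measurable fun p : ℝ × ℝ => (p.1, c * p.1 + p.2) := by fun_prop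
  have hcomp : (fun ω => (T ω, X ω))
      = (fun p : ℝ × ℝ => (p.1, c * p.1 + p.2)) ∘ fun ω => (T ω, X ω - c * T ω) := by
    ext ω <;> simp
  have hind := (indepFun_iff_map_prod_eq_prod_map_map hT.aemeasurable
    (by fun_prop)).mp h.indep
  have : IsProbabilityMeasure (P.map T) := Measure.isProbabilityMeasure_map hT.aemeasurable
  -- the pair is the image of a product measure under the shear `(t, w) ↦ (t, c t + w)`
  rw [hcomp, ← Measure.map_map hφ (by fun_prop), hind, h.map_residual]
  ext A hA
  rw [Measure.map_apply hφ hA, Measure.prod_apply (hφ hA), Measure.compProd_apply hA]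
  refine lintegral_congr fun t => ?_
  have e : gaussianReal (c * t) v = (gaussianReal 0 v).map (c * t + ·) := by
    rw [gaussianReal_map_const_add, zero_add]
  rw [gaussianRegression_apply, e, Measure.map_apply (by fun_prop) (measurable_prodMk_left hA)]
  rfl

lemma mutualInfo_eq (h : IsGaussianRegression P T X c s v) :
    mutualInfo P T X = ((-(1 / 2) * Real.log v : ℝ) : EReal) := by
  have hT := h.measurable_left
  have hX := h.measurable_right
  have hv : (v : ℝ) ≠ 0 := by simpa using h.residual_ne_zero
  have : IsProbabilityMeasure (P.map T) := Measure.isProbabilityMeasure_map hT.aemeasurable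
  have : IsProbabilityMeasure (P.map X) := Measure.isProbabilityMeasure_map hX.aemeasurable
  have : IsProbabilityMeasure (P.map fun ω => (T ω, X ω)) :=
    Measure.isProbabilityMeasure_map (hT.prodMk hX).aemeasurable
  have hl : Measurable fun p : ℝ × ℝ => gaussianLLR v (c * p.1) p.2 := by
    unfold gaussianLLR; fun_prop
  have hd : P.map (fun ω => (T ω, X ω)) = ((P.map T).prod (P.map X)).withDensity
      fun p => ENNReal.ofReal (Real.exp (gaussianLLR v (c * p.1) p.2)) := by
    rw [h.map_prodMk, h.map_right]
    exact compProd_eq_withDensity (D := fun t x => ENNReal.ofReal (Real.exp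
      (gaussianLLR v (c * t) x))) (by simpa [Function.uncurry_def] using by fun_prop)
      fun t => gaussianReal_eq_withDensity_gaussianLLR _ h.residual_ne_zero
  have i0 : Integrable (fun _ : Ω => -(1 / 2) * Real.log v) P := integrable_const _
  have i1 := h.integrable_sq_residual.div_const (2 * v)
  have i2 := h.integrable_sq_right.div_const 2
  have hint : Integrable (fun ω => gaussianLLR v (c * T ω) (X ω)) P := (i0.sub i1).add i2
  have hval : ∫ ω, gaussianLLR v (c * T ω) (X ω) ∂P = -(1 / 2) * Real.log v := by
    have e1 := integral_add (i0.sub i1) i2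
    simp only [Pi.sub_apply] at e1
    unfold gaussianLLR
    rw [e1, integral_sub i0 i1, integral_div, integral_div, h.integral_sq_residual,
      h.integral_sq_right]
    simp
    field_simp
    ring
  have hle : v ≤ 1 := by
    have h1 := h.variance_eq
    have h2 : 0 ≤ c ^ 2 * s := by positivity
    exact_mod_cast (by linarith : (v : ℝ) ≤ 1)
  rw [mutualInfo, klDiv_of_eq_withDensity_exp hl hd
    ((integrable_map_measure hl.aestronglyMeasurable (hT.prodMk hX).aemeasurable).mpr hint),
    integral_map (hT.prodMk hX).aemeasurable hl.aestronglyMeasurable, hval,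
    EReal.coe_ennreal_ofReal, max_eq_left]
  have := Real.log_nonpos v.coe_nonneg (by exact_mod_cast hle)
  linarith

lemma specificInfo_ae_eq (h : IsGaussianRegression P T X c s v) :
    ∀ᵐ ω ∂P, specificInfo P T X (T ω)
      = ENNReal.ofReal (((c * T ω) ^ 2 + v - 1 - Real.log v) / 2) := by
  have h1 := condDistrib_ae_eq_of_measure_eq_compProd T h.measurable_right.aemeasurable
    h.map_prodMk
  filter_upwards [ae_of_ae_map h.measurable_left.aemeasurable h1] with ω hω
  rw [specificInfo, hω, gaussianRegression_apply, h.map_right,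
    klDiv_gaussianReal_standard _ h.residual_ne_zero]

lemma map_prodMk_swap (h : IsGaussianRegression P T X c s v) :
    P.map (fun ω => (X ω, T ω)) = volume.withDensity
      fun p : ℝ × ℝ => gaussianPDF 0 s p.2 * gaussianPDF (c * p.2) v p.1 := by
  have hT := h.measurable_left
  have hX := h.measurable_right
  have hswap : (fun ω => (X ω, T ω)) = Prod.swap ∘ fun ω => (T ω, X ω) := rfl
  have hm : Measurable fun p : ℝ × ℝ => gaussianPDF 0 s p.2 * gaussianPDF (c * p.2) v p.1 := by
    unfold gaussianPDF gaussianPDFReal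
    fun_prop
  rw [hswap, ← Measure.map_map measurable_swap (hT.prodMk hX), h.map_prodMk]
  refine Measure.ext_of_lintegral _ fun f hf => ?_
  rw [lintegral_map hf measurable_swap, Measure.lintegral_compProd (by fun_prop),
    lintegral_withDensity_eq_lintegral_mul _ hm hf, h.map_left,
    gaussianReal_of_var_ne_zero _ h.left_ne_zero,
    lintegral_withDensity_eq_lintegral_mul _ (measurable_gaussianPDF _ _)
    (Measurable.lintegral_kernel_prod_right' (κ := gaussianRegression c v)
      (f := fun p => f p.swap) (by fun_prop)),
    Measure.volume_eq_prod, lintegral_prod_symm _ (by fun_prop)]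
  refine lintegral_congr fun t => ?_
  have hft : Measurable fun x => f (x, t) := by fun_prop
  simp only [Pi.mul_apply, gaussianRegression_apply, Prod.swap_prod_mk]
  rw [gaussianReal_of_var_ne_zero _ h.residual_ne_zero,
    lintegral_withDensity_eq_lintegral_mul _ (measurable_gaussianPDF _ _) hft,
    ← lintegral_const_mul _ (by fun_prop)]
  simp only [Pi.mul_apply, mul_assoc]

lemma condInfoContent_ae_eq (h : IsGaussianRegression P T X c s v) :
    ∀ᵐ ω ∂P, condInfoContent P T X ω = (((X ω - c * T ω) ^ 2 / (2 * v) +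
      ((1 / 2) * Real.log (2 * Real.pi) + (1 / 2) * Real.log v) : ℝ) : EReal) := by
  have hT := h.measurable_left
  have hX := h.measurable_right
  have hm : Measurable fun p : ℝ × ℝ => gaussianPDF 0 s p.2 * gaussianPDF (c * p.2) v p.1 := by
    unfold gaussianPDF gaussianPDFReal
    fun_prop
  have h1 := ae_pdf_comp_eq hT (measurable_gaussianPDF 0 s)
    (by rw [h.map_left, gaussianReal_of_var_ne_zero _ h.left_ne_zero])
  have h2 := ae_pdf_comp_eq (hX.prodMk hT) hm h.map_prodMk_swap
  filter_upwards [h1, h2] with ω h1 h2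
  rw [condInfoContent, h1, h2, mul_comm, ENNReal.mul_div_cancel_right
    (gaussianPDF_pos _ h.left_ne_zero _).ne' gaussianPDF_ne_top, gaussianPDF,
    ENNReal.log_ofReal_of_pos (gaussianPDFReal_pos _ _ _ h.residual_ne_zero),
    log_gaussianPDFReal _ _ h.residual_ne_zero, ← EReal.coe_neg]
  congr 1
  ring

end IsGaussianRegression

/-! ### Redundancies of two predictors -/

section TwoPredictors

variable {Ω : Type*} [MeasurableSpace Ω] {P : Measure Ω} [IsProbabilityMeasure P]
  {T X Y : Ω → ℝ} {c₁ c₂ : ℝ} {s v₁ v₂ : NNReal}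

/-- `x - log x` decreases on `(0, 1]`. -/
lemma sub_log_le_sub_log {x y : ℝ} (hx : 0 < x) (hxy : x ≤ y) (hy : y ≤ 1) :
    y - Real.log y ≤ x - Real.log x := by
  have hy0 : 0 < y := hx.trans_le hxy
  have h1 := Real.one_sub_inv_le_log_of_pos (div_pos hy0 hx)
  rw [Real.log_div hy0.ne' hx.ne', inv_div] at h1
  have h2 : y - x ≤ 1 - x / y := by
    rw [one_sub_div hy0.ne', le_div_iff₀ hy0]
    nlinarith
  linarith

/-- If `Y` has the smaller residual variance, its specific information dominates that of `X` at
every outcome, so the minimum is attained by `X` throughout. -/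
lemma minRedundancy_eq (h₁ : IsGaussianRegression P T X c₁ s v₁)
    (h₂ : IsGaussianRegression P T Y c₂ s v₂) (hv : v₂ ≤ v₁) :
    minRedundancy P T X Y = ((-(1 / 2) * Real.log v₁ : ℝ) : EReal) := by
  have hT := h₁.measurable_left
  have hs : (0 : ℝ) < s := by have := h₁.left_ne_zero; positivity
  have p1 : (0 : ℝ) < v₁ := by have := h₁.residual_ne_zero; positivity
  have p2 : (0 : ℝ) < v₂ := by have := h₂.residual_ne_zero; positivity
  have e1 := h₁.variance_eq
  have e2 := h₂.variance_eq
  have hv' : (v₂ : ℝ) ≤ v₁ := by exact_mod_cast hv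
  have hc : c₁ ^ 2 ≤ c₂ ^ 2 := le_of_mul_le_mul_right (by linarith) hs
  have hlog : (v₁ : ℝ) - Real.log v₁ ≤ v₂ - Real.log v₂ :=
    sub_log_le_sub_log p2 hv' (by nlinarith [sq_nonneg c₁])
  have hae : ∀ᵐ ω ∂P, min (specificInfo P T X (T ω)) (specificInfo P T Y (T ω))
      = ENNReal.ofReal (((c₁ * T ω) ^ 2 + v₁ - 1 - Real.log v₁) / 2) := by
    filter_upwards [h₁.specificInfo_ae_eq, h₂.specificInfo_ae_eq] with ω w1 w2
    rw [w1, w2, min_eq_left]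
    refine ENNReal.ofReal_le_ofReal ?_
    have := mul_le_mul_of_nonneg_right hc (sq_nonneg (T ω))
    rw [mul_pow, mul_pow]
    linarith
  have hTsq : Integrable (fun ω => T ω ^ 2) P := by
    have := integrable_sq_gaussianReal 0 s 0
    rw [← h₁.map_left] at this
    simpa using! (integrable_map_measure (by fun_prop) hT.aemeasurable).mp this
  have hTs : ∫ ω, T ω ^ 2 ∂P = s := by
    have := integral_sq_gaussianReal 0 s
    rw [← h₁.map_left, integral_map hT.aemeasurable (by fun_prop)] at this
    simpa using this
  have hfun : (fun ω => ((c₁ * T ω) ^ 2 + v₁ - 1 - Real.log v₁) / 2)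
      = fun ω => c₁ ^ 2 / 2 * T ω ^ 2 + (v₁ - 1 - Real.log v₁) / 2 := by
    ext ω; ring
  have hint : Integrable (fun ω => ((c₁ * T ω) ^ 2 + v₁ - 1 - Real.log v₁) / 2) P := by
    rw [hfun]
    exact (hTsq.const_mul _).add (integrable_const _)
  have hval : ∫ ω, ((c₁ * T ω) ^ 2 + v₁ - 1 - Real.log v₁) / 2 ∂P = -(1 / 2) * Real.log v₁ := by
    rw [hfun, integral_add (hTsq.const_mul _) (integrable_const _), integral_const_mul, hTs]
    simp
    linarith
  have hnn : 0 ≤ᵐ[P] fun ω => ((c₁ * T ω) ^ 2 + v₁ - 1 - Real.log v₁) / 2 := by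
    refine ae_of_all _ fun ω => ?_
    have := Real.log_le_sub_one_of_pos p1
    have := sq_nonneg (c₁ * T ω)
    simp only [Pi.zero_apply]
    linarith
  rw [minRedundancy, lintegral_congr_ae hae, ← ofReal_integral_eq_lintegral_ofReal hint hnn,
    EReal.coe_ennreal_ofReal, max_eq_left (integral_nonneg_of_ae hnn), hval]

/-- If the standardized squared residuals coincide and `Y` has the smaller residual variance, the
pointwise minimum is attained by `Y` throughout. -/
lemma pmAmbiguity_eq (h₁ : IsGaussianRegression P T X c₁ s v₁)
    (h₂ : IsGaussianRegression P T Y c₂ s v₂) (hv : v₂ ≤ v₁)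
    (hres : ∀ ω, (X ω - c₁ * T ω) ^ 2 / (2 * v₁) = (Y ω - c₂ * T ω) ^ 2 / (2 * v₂)) :
    pmAmbiguity P T X Y =
      ((1 / 2 + ((1 / 2) * Real.log (2 * Real.pi) + (1 / 2) * Real.log v₂) : ℝ) : EReal) := by
  have p2 : (0 : ℝ) < v₂ := by have := h₂.residual_ne_zero; positivity
  have hv' : (v₂ : ℝ) ≤ v₁ := by exact_mod_cast hv
  have hlog := Real.log_le_log p2 hv'
  have hae : ∀ᵐ ω ∂P, min (condInfoContent P T X ω) (condInfoContent P T Y ω)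
      = (((Y ω - c₂ * T ω) ^ 2 / (2 * v₂) +
        ((1 / 2) * Real.log (2 * Real.pi) + (1 / 2) * Real.log v₂) : ℝ) : EReal) := by
    filter_upwards [h₁.condInfoContent_ae_eq, h₂.condInfoContent_ae_eq] with ω w1 w2
    rw [w1, w2, min_eq_right]
    rw [EReal.coe_le_coe_iff, hres]
    linarith
  have i1 := h₂.integrable_sq_residual.div_const (2 * v₂)
  rw [pmAmbiguity, extExpectation_coe (i1.add (integrable_const _)) hae]
  congr 1
  have e1 := integral_add i1 (integrable_const (μ := P)
    ((1 / 2) * Real.log (2 * Real.pi) + (1 / 2) * Real.log v₂))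
  simp only [Pi.add_apply]
  rw [e1, integral_div, h₂.integral_sq_residual]
  simp
  field_simp

lemma pmSpecificity_eq (h₁ : IsGaussianRegression P T X c₁ s v₁)
    (h₂ : IsGaussianRegression P T Y c₂ s v₂) :
    pmSpecificity P X Y =
      ((1 / 2 - (∫ ω, |X ω ^ 2 - Y ω ^ 2| ∂P) / 4 + (1 / 2) * Real.log (2 * Real.pi) : ℝ)
        : EReal) := by
  have hae : ∀ᵐ ω ∂P, min (infoContent P X ω) (infoContent P Y ω)
      = (((X ω ^ 2 + Y ω ^ 2) / 4 - |X ω ^ 2 - Y ω ^ 2| / 4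
        + (1 / 2) * Real.log (2 * Real.pi) : ℝ) : EReal) := by
    filter_upwards [h₁.infoContent_ae_eq, h₂.infoContent_ae_eq] with ω w1 w2
    rw [w1, w2, ← EReal.coe_strictMono.monotone.map_min, min_add_add_right]
    congr 2
    rcases le_total (X ω ^ 2) (Y ω ^ 2) with h | h
    · rw [min_eq_left (by linarith), abs_of_nonpos (by linarith)]; ring
    · rw [min_eq_right (by linarith), abs_of_nonneg (by linarith)]; ring
  have i1 := (h₁.integrable_sq_right.add h₂.integrable_sq_right).div_const 4
  have i2 := (h₁.integrable_sq_right.sub h₂.integrable_sq_right).abs.div_const 4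
  have i3 := integrable_const (μ := P) ((1 / 2) * Real.log (2 * Real.pi))
  rw [pmSpecificity, extExpectation_coe ((i1.sub i2).add i3) hae]
  congr 1
  have e1 := integral_add (i1.sub i2) i3
  have e2 := integral_sub i1 i2
  have e3 := integral_add h₁.integrable_sq_right h₂.integrable_sq_right
  simp only [Pi.sub_apply, Pi.add_apply, integral_div] at e1 e2 e3 ⊢
  rw [e1, e2, e3, h₁.integral_sq_right, h₂.integral_sq_right]
  simp
  ring

end TwoPredictors

/-! ### The correlated Gaussian pair -/

lemma IsNormalizedGaussianPair.symm {Ω : Type*} [MeasurableSpace Ω] {P : Measure Ω}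
    {X Y : Ω → ℝ} {ρ : ℝ} (h : IsNormalizedGaussianPair P X Y ρ) :
    IsNormalizedGaussianPair P Y X ρ where
  measurable_fst := h.measurable_snd
  measurable_snd := h.measurable_fst
  hasGaussianLaw := by
    have := h.hasGaussianLaw.map_fun
      ((ContinuousLinearMap.snd ℝ ℝ ℝ).prod (ContinuousLinearMap.fst ℝ ℝ ℝ))
    simpa using this
  mean_fst := h.mean_snd
  mean_snd := h.mean_fst
  variance_fst := h.variance_snd
  variance_snd := h.variance_fst
  covariance_eq := by rw [covariance_comm, h.covariance_eq]

section GaussianPair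

namespace IsNormalizedGaussianPair

variable {Ω : Type*} [MeasurableSpace Ω] {P : Measure Ω} [IsProbabilityMeasure P]
  {T X Y : Ω → ℝ} {ρ a b : ℝ}

/-- `X² - Y²` factors into the independent Gaussians `X - Y` and `X + Y`. -/
lemma integral_abs_sq_sub_sq (h : IsNormalizedGaussianPair P X Y ρ) (hρ₀ : 0 < ρ) (hρ₁ : ρ < 1) :
    ∫ ω, |X ω ^ 2 - Y ω ^ 2| ∂P = 4 / Real.pi * Real.sqrt (1 - ρ ^ 2) := by
  have hX := h.measurable_fst
  have hY := h.measurable_snd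
  have hG := h.hasGaussianLaw
  have hXL := hG.fst.memLp_two
  have hYL := hG.snd.memLp_two
  have hpair : HasGaussianLaw (fun ω => ((X - Y) ω, (X + Y) ω)) P := by
    have := hG.map_fun ((ContinuousLinearMap.fst ℝ ℝ ℝ - ContinuousLinearMap.snd ℝ ℝ ℝ).prod
      (ContinuousLinearMap.fst ℝ ℝ ℝ + ContinuousLinearMap.snd ℝ ℝ ℝ))
    simpa using this
  have hcov : covariance (X - Y) (X + Y) P = 0 := by
    rw [covariance_sub_left hXL hYL (hXL.add hYL), covariance_add_right hXL hXL hYL,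
      covariance_add_right hYL hXL hYL, covariance_self hX.aemeasurable,
      covariance_self hY.aemeasurable, h.variance_fst, h.variance_snd, covariance_comm]
    ring
  have hind := hpair.indepFun_of_covariance_eq_zero hcov
  have habs := hind.comp (φ := fun x : ℝ => |x|) (ψ := fun x : ℝ => |x|) (by fun_prop)
    (by fun_prop)
  have hprod := IndepFun.integral_fun_mul_eq_mul_integral habs
    (by simpa [Function.comp_def] using (by fun_prop))
    (by simpa [Function.comp_def] using (by fun_prop))
  have key : ∀ (Z : Ω → ℝ) (w : ℝ), Measurable Z → HasGaussianLaw Z P → ∫ ω, Z ω ∂P = 0 →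
      variance Z P = w → 0 ≤ w → ∫ ω, |Z ω| ∂P = Real.sqrt (2 * w / Real.pi) := by
    intro Z w hZ hZG hZ0 hZv hw
    have e := integral_abs_gaussianReal w.toNNReal
    have hl := hZG.map_eq_gaussianReal
    rw [hZ0, hZv] at hl
    rw [← hl, integral_map hZ.aemeasurable (by fun_prop), Real.coe_toNNReal _ hw] at e
    exact e
  have e1 := key (X - Y) (2 * (1 - ρ)) (hX.sub hY) hpair.fst
    (by simp only [Pi.sub_apply]
        rw [integral_sub hG.fst.integrable hG.snd.integrable, h.mean_fst, h.mean_snd, sub_zero])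
    (by rw [variance_sub hXL hYL, h.variance_fst, h.variance_snd, h.covariance_eq]; ring)
    (by linarith)
  have e2 := key (X + Y) (2 * (1 + ρ)) (hX.add hY) hpair.snd
    (by simp only [Pi.add_apply]
        rw [integral_add hG.fst.integrable hG.snd.integrable, h.mean_fst, h.mean_snd, add_zero])
    (by rw [variance_add hXL hYL, h.variance_fst, h.variance_snd, h.covariance_eq]; ring)
    (by linarith)
  have hfac : ∀ ω, |X ω ^ 2 - Y ω ^ 2| = |(X - Y) ω| * |(X + Y) ω| := by
    intro ω
    rw [← abs_mul]
    congr 1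
    simp only [Pi.sub_apply, Pi.add_apply]
    ring
  simp only [Function.comp_def] at hprod
  simp_rw [hfac]
  have hpi := Real.pi_pos
  rw [hprod, e1, e2, ← Real.sqrt_mul (div_nonneg (by linarith) hpi.le),
    show 2 * (2 * (1 - ρ)) / Real.pi * (2 * (2 * (1 + ρ)) / Real.pi)
      = (4 / Real.pi) ^ 2 * (1 - ρ ^ 2) by ring,
    Real.sqrt_mul (by positivity), Real.sqrt_sq (by positivity)]

/-- The regression of the first predictor on `T = aX + bY`. -/
lemma regression_fst (h : IsNormalizedGaussianPair P X Y ρ) (hρ : ρ ^ 2 < 1) (hb : b ≠ 0)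
    (hT : ∀ ω, T ω = a * X ω + b * Y ω) :
    IsGaussianRegression P T X ((a + b * ρ) / (a ^ 2 + 2 * a * b * ρ + b ^ 2))
      (a ^ 2 + 2 * a * b * ρ + b ^ 2).toNNReal
      (b ^ 2 * (1 - ρ ^ 2) / (a ^ 2 + 2 * a * b * ρ + b ^ 2)).toNNReal := by
  obtain rfl : T = fun ω => a * X ω + b * Y ω := funext hT
  have hX := h.measurable_fst
  have hY := h.measurable_snd
  have hG := h.hasGaussianLaw
  have hXL := hG.fst.memLp_two
  have hYL := hG.snd.memLp_two
  have hb2 : 0 < b ^ 2 * (1 - ρ ^ 2) := by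
    have : 0 < b ^ 2 := by positivity
    exact mul_pos this (by linarith)
  have hs : 0 < a ^ 2 + 2 * a * b * ρ + b ^ 2 := by nlinarith [sq_nonneg (a + b * ρ)]
  have hv := div_pos hb2 hs
  refine isGaussianRegression_of_hasGaussianLaw (by fun_prop) hX ?_ ?_ h.mean_fst (by simpa)
    (by simpa) ?_ h.variance_fst ?_ ?_
  · have := hG.map_fun ((a • ContinuousLinearMap.fst ℝ ℝ ℝ + b • ContinuousLinearMap.snd ℝ ℝ ℝ).prod
      (ContinuousLinearMap.fst ℝ ℝ ℝ))
    simpa using this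
  · rw [integral_add (hG.fst.integrable.const_mul a) (hG.snd.integrable.const_mul b),
      integral_const_mul, integral_const_mul, h.mean_fst, h.mean_snd]
    simp
  · have := variance_add (hXL.const_mul a) (hYL.const_mul b)
    rw [variance_const_mul, variance_const_mul, covariance_const_mul_left,
      covariance_const_mul_right, h.variance_fst, h.variance_snd, h.covariance_eq] at this
    rw [Real.coe_toNNReal _ hs.le]
    refine (show _ = _ from this).trans ?_
    ring
  · have := covariance_add_left (hXL.const_mul a) (hYL.const_mul b) hXL
    rw [covariance_const_mul_left, covariance_const_mul_left, covariance_self hX.aemeasurable,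
      h.variance_fst, covariance_comm Y, h.covariance_eq] at this
    rw [Real.coe_toNNReal _ hs.le, div_mul_cancel₀ _ hs.ne']
    refine (show _ = _ from this).trans ?_
    ring
  · rw [Real.coe_toNNReal _ hs.le, Real.coe_toNNReal _ hv.le]
    obtain ⟨S, hS⟩ : ∃ S, S = a ^ 2 + 2 * a * b * ρ + b ^ 2 := ⟨_, rfl⟩
    rw [← hS] at hs ⊢
    field_simp
    rw [hS]
    ring

/-- The regression of the second predictor on `T = aX + bY`. -/
lemma regression_snd (h : IsNormalizedGaussianPair P X Y ρ) (hρ : ρ ^ 2 < 1) (ha : a ≠ 0)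
    (hT : ∀ ω, T ω = a * X ω + b * Y ω) :
    IsGaussianRegression P T Y ((b + a * ρ) / (a ^ 2 + 2 * a * b * ρ + b ^ 2))
      (a ^ 2 + 2 * a * b * ρ + b ^ 2).toNNReal
      (a ^ 2 * (1 - ρ ^ 2) / (a ^ 2 + 2 * a * b * ρ + b ^ 2)).toNNReal := by
  have := h.symm.regression_fst (a := b) (b := a) hρ ha (fun ω => (hT ω).trans (add_comm _ _))
  rwa [show b ^ 2 + 2 * b * a * ρ + a ^ 2 = a ^ 2 + 2 * a * b * ρ + b ^ 2 by ring] at this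

lemma mutualInfo_eq (h : IsNormalizedGaussianPair P X Y ρ) (hρ : ρ ^ 2 < 1) :
    mutualInfo P X Y = ((-(1 / 2) * Real.log (1 - ρ ^ 2) : ℝ) : EReal) := by
  have := (h.symm.regression_fst (T := X) (a := 0) (b := 1) hρ one_ne_zero (by simp)).mutualInfo_eq
  rwa [show 1 ^ 2 * (1 - ρ ^ 2) / (0 ^ 2 + 2 * 0 * 1 * ρ + 1 ^ 2) = 1 - ρ ^ 2 by ring,
    Real.coe_toNNReal _ (by linarith)] at this

end IsNormalizedGaussianPair

end GaussianPair

/-! ### The information quantities of the pair at a fixed coefficient -/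

/-- `Var(X | T) = b²(1 - ρ²) / Var T` for `T = aX + bY`; exchanging `a` and `b` gives
`Var(Y | T)`. -/
noncomputable def residualVar (ρ a b : ℝ) : ℝ :=
  b ^ 2 * (1 - ρ ^ 2) / (a ^ 2 + 2 * a * b * ρ + b ^ 2)

/-- The mutual information `I(T; X) = -½ log Var(X | T)` for `T = aX + bY`. -/
noncomputable def gaussianInfo (ρ a b : ℝ) : ℝ :=
  -(1 / 2) * Real.log (residualVar ρ a b)

lemma residualVar_pos {ρ a b : ℝ} (hρ : ρ ^ 2 < 1) (hb : 0 < b) : 0 < residualVar ρ a b :=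
  div_pos (mul_pos (by positivity) (by linarith))
    (by nlinarith [sq_nonneg (a + b * ρ), mul_pos (pow_pos hb 2) (sub_pos.mpr hρ)])

lemma residualVar_swap (ρ a b : ℝ) :
    residualVar ρ b a = a ^ 2 * (1 - ρ ^ 2) / (a ^ 2 + 2 * a * b * ρ + b ^ 2) := by
  rw [residualVar]
  congr 1
  ring

section Values

variable {Ω : Type*} [MeasurableSpace Ω] {P : Measure Ω} [IsProbabilityMeasure P]
  {T X Y : Ω → ℝ} {ρ a b : ℝ}

/-- With `Var(Y | T) < Var(X | T)`, both redundancies are explicit: `R^min` is `I(T; X)` and `R^PM`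
differs from `I(T; Y)` by a constant that does not depend on `a`. -/
lemma IsNormalizedGaussianPair.information_values (h : IsNormalizedGaussianPair P X Y ρ)
    (hρ₀ : 0 < ρ) (hρ₁ : ρ < 1) (ha : 0 < a) (hab : a < b)
    (hT : ∀ ω, T ω = a * X ω + b * Y ω) :
    mutualInfo P T X = (gaussianInfo ρ a b : ℝ) ∧ mutualInfo P T Y = (gaussianInfo ρ b a : ℝ) ∧
      mutualInfo P T (fun ω => (X ω, Y ω)) = ⊤ ∧
      minRedundancy P T X Y = (gaussianInfo ρ a b : ℝ) ∧
      pmRedundancy P T X Y =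
        ((gaussianInfo ρ b a - 1 / Real.pi * Real.sqrt (1 - ρ ^ 2) : ℝ) : EReal) := by
  have hρ : ρ ^ 2 < 1 := by nlinarith
  have hb : 0 < b := ha.trans hab
  have hs : 0 < a ^ 2 + 2 * a * b * ρ + b ^ 2 := by positivity
  have h₁ := h.regression_fst hρ hb.ne' hT
  have h₂ := h.regression_snd hρ ha.ne' hT
  have hv₁ := residualVar_pos (a := a) hρ hb
  have hv₂ := residualVar_pos (a := b) hρ ha
  rw [← residualVar] at h₁
  rw [← residualVar_swap] at h₂
  have hle : residualVar ρ b a ≤ residualVar ρ a b := by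
    rw [residualVar_swap, residualVar]
    gcongr
  have hle' := Real.toNNReal_le_toNNReal hle
  have c₁ := Real.coe_toNNReal _ hv₁.le
  have c₂ := Real.coe_toNNReal _ hv₂.le
  have hnull : NullSingletonClass (P.map T) := by
    rw [h₁.map_left]
    exact nullSingletonClass_gaussianReal h₁.left_ne_zero
  -- `a (X - E[X|T]) + b (Y - E[Y|T]) = 0`, and the standard deviations are in the ratio `b : a`
  have hres : ∀ ω,
      (X ω - (a + b * ρ) / (a ^ 2 + 2 * a * b * ρ + b ^ 2) * T ω) ^ 2 /
        (2 * ((residualVar ρ a b).toNNReal : ℝ)) =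
      (Y ω - (b + a * ρ) / (a ^ 2 + 2 * a * b * ρ + b ^ 2) * T ω) ^ 2 /
        (2 * ((residualVar ρ b a).toNNReal : ℝ)) := by
    intro ω
    rw [c₁, c₂, residualVar_swap, residualVar, hT]
    have h1 : 1 - ρ ^ 2 ≠ 0 := by linarith
    obtain ⟨S, hS⟩ : ∃ S, S = a ^ 2 + 2 * a * b * ρ + b ^ 2 := ⟨_, rfl⟩
    rw [← hS] at hs ⊢
    field_simp
    rw [hS]
    ring
  have hamb := pmAmbiguity_eq h₁ h₂ hle' hres
  have hspec := pmSpecificity_eq h₁ h₂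
  have hmin := minRedundancy_eq h₁ h₂ hle'
  have m₁ := h₁.mutualInfo_eq
  have m₂ := h₂.mutualInfo_eq
  rw [c₁] at hmin m₁
  rw [c₂] at hamb m₂
  refine ⟨m₁, m₂, ?_, hmin, ?_⟩
  · exact mutualInfo_comp_eq_top (g := fun p : ℝ × ℝ => a * p.1 + b * p.2)
      (h.measurable_fst.prodMk h.measurable_snd) (by fun_prop) hT
  · rw [pmRedundancy, hspec, hamb, ← EReal.coe_sub, h.integral_abs_sq_sub_sq hρ₀ hρ₁, gaussianInfo]
    congr 1
    ring

end Values

/-! ### Asymptotics as the coefficient of the first predictor vanishes -/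

lemma tendsto_gaussianInfo_fst (ρ : ℝ) {b : ℝ} (hρ : ρ ^ 2 < 1) (hb : 0 < b) :
    Tendsto (fun a => gaussianInfo ρ a b) (𝓝[>] 0) (𝓝 (-(1 / 2) * Real.log (1 - ρ ^ 2))) := by
  have h0 : residualVar ρ 0 b = 1 - ρ ^ 2 := by
    rw [residualVar]
    field_simp
    ring
  have hc : ContinuousAt (fun a => gaussianInfo ρ a b) 0 := by
    have : ContinuousAt (fun a => residualVar ρ a b) 0 := by
      unfold residualVar
      exact ContinuousAt.div (by fun_prop) (by fun_prop) (by simpa using hb.ne')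
    exact continuousAt_const.mul (this.log (by rw [h0]; linarith))
  have := hc.tendsto.mono_left (nhdsWithin_le_nhds (s := Set.Ioi 0))
  rwa [gaussianInfo, h0] at this

lemma tendsto_gaussianInfo_snd (ρ : ℝ) {b : ℝ} (hρ : ρ ^ 2 < 1) (hb : 0 < b) :
    Tendsto (fun a => gaussianInfo ρ b a) (𝓝[>] 0) atTop := by
  have hc : ContinuousAt (fun a => residualVar ρ b a) 0 := by
    unfold residualVar
    exact ContinuousAt.div (by fun_prop) (by fun_prop) (by simpa using hb.ne')
  have h0 : Tendsto (fun a => residualVar ρ b a) (𝓝[>] 0) (𝓝[>] 0) := by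
    refine tendsto_nhdsWithin_iff.mpr ⟨?_, ?_⟩
    · simpa [residualVar] using hc.tendsto.mono_left (nhdsWithin_le_nhds (s := Set.Ioi 0))
    · filter_upwards [self_mem_nhdsWithin] with a ha using residualVar_pos hρ ha
  exact (Real.tendsto_log_nhdsGT_zero.comp h0).const_mul_atBot_of_neg (by norm_num)

lemma tendsto_sub_div_sub_one {α : Type*} {l : Filter α} {g h₁ h₂ : α → ℝ} {x₁ x₂ : ℝ}
    (hg : Tendsto g l atTop) (h1 : Tendsto h₁ l (𝓝 x₁)) (h2 : Tendsto h₂ l (𝓝 x₂)) :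
    Tendsto (fun a => (g a - h₁ a) / (g a - h₂ a)) l (𝓝 1) := by
  have e : Tendsto (fun a => (1 - h₁ a / g a) / (1 - h₂ a / g a)) l (𝓝 ((1 - 0) / (1 - 0))) :=
    (tendsto_const_nhds.sub (h1.div_atTop hg)).div (tendsto_const_nhds.sub (h2.div_atTop hg))
      (by norm_num)
  rw [sub_zero, div_one] at e
  refine e.congr' ?_
  filter_upwards [hg.eventually_gt_atTop 0] with a ha
  rw [one_sub_div ha.ne', one_sub_div ha.ne', div_div_div_cancel_right₀ ha.ne']

end PID

theorem mainTheorem4 {Ω : Type*} [MeasurableSpace Ω] (P : Measure Ω) [IsProbabilityMeasure P]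
    (b ρ : ℝ) (hb : 0 < b) (hρ₀ : 0 < ρ) (hρ₁ : ρ < 1)
    (X Y : Ω → ℝ) (hXY : PID.IsNormalizedGaussianPair P X Y ρ)
    (T : ℝ → Ω → ℝ) (hT : ∀ a ω, T a ω = a * X ω + b * Y ω) :
    -- limits and fixed values of the atoms based on the minimum specific information
    (Tendsto (fun a => (PID.dMin P (T a) X Y).R) (𝓝[>] 0) (𝓝 (PID.mutualInfo P X Y)) ∧
      PID.mutualInfo P X Y = ((-Real.log (Real.sqrt (1 - ρ ^ 2)) : ℝ) : EReal) ∧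
      (∀ a ∈ Set.Ioo 0 b, (PID.dMin P (T a) X Y).UX = 0) ∧
      Tendsto (fun a => (PID.dMin P (T a) X Y).UY) (𝓝[>] 0) (𝓝 ⊤) ∧
      (∀ a ∈ Set.Ioo 0 b, (PID.dMin P (T a) X Y).S = ⊤)) ∧
    -- limits and fixed values of the atoms based on the pointwise redundancy
    (Tendsto (fun a => (PID.dPM P (T a) X Y).R) (𝓝[>] 0) (𝓝 ⊤) ∧
      Tendsto (fun a => (PID.dPM P (T a) X Y).UX) (𝓝[>] 0) (𝓝 ⊥) ∧
      (∀ a ∈ Set.Ioo 0 b, (PID.dPM P (T a) X Y).UY =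
        ((1 / Real.pi * Real.sqrt (1 - ρ ^ 2) : ℝ) : EReal)) ∧
      (∀ a ∈ Set.Ioo 0 b, (PID.dPM P (T a) X Y).S = ⊤)) ∧
    -- limits of ratios
    (Tendsto (fun a => (PID.dMin P (T a) X Y).UY / PID.mutualInfo P (T a) Y) (𝓝[>] 0) (𝓝 1) ∧
      Tendsto (fun a => (PID.dMin P (T a) X Y).R / PID.mutualInfo P (T a) Y) (𝓝[>] 0) (𝓝 0)) ∧
    (Tendsto (fun a => (PID.dPM P (T a) X Y).UX / PID.mutualInfo P (T a) Y) (𝓝[>] 0) (𝓝 (-1)) ∧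
      Tendsto (fun a => (PID.dPM P (T a) X Y).UX / (PID.dPM P (T a) X Y).R)
        (𝓝[>] 0) (𝓝 (-1)) ∧
      Tendsto (fun a => (PID.dPM P (T a) X Y).R / PID.mutualInfo P (T a) Y) (𝓝[>] 0) (𝓝 1)) ∧
    (Tendsto (fun a => (PID.dPM P (T a) X Y).UX / (PID.dMin P (T a) X Y).UY)
        (𝓝[>] 0) (𝓝 (-1)) ∧
      Tendsto (fun a => (PID.dMin P (T a) X Y).UY / (PID.dPM P (T a) X Y).R)
        (𝓝[>] 0) (𝓝 1)) := by
  have hρ : ρ ^ 2 < 1 := by nlinarith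
  -- `k` is the value of `U_Y^PM`; `f` and `g` are `I(T; X)` and `I(T; Y)` as functions of `a`
  obtain ⟨k, hk⟩ : ∃ k, k = 1 / Real.pi * Real.sqrt (1 - ρ ^ 2) := ⟨_, rfl⟩
  obtain ⟨f, hf⟩ : ∃ f : ℝ → ℝ, f = fun a => PID.gaussianInfo ρ a b := ⟨_, rfl⟩
  obtain ⟨g, hg⟩ : ∃ g : ℝ → ℝ, g = fun a => PID.gaussianInfo ρ b a := ⟨_, rfl⟩
  have hval : ∀ a ∈ Set.Ioo 0 b, PID.mutualInfo P (T a) X = (f a : ℝ) ∧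
      PID.mutualInfo P (T a) Y = (g a : ℝ) ∧
      PID.mutualInfo P (T a) (fun ω => (X ω, Y ω)) = ⊤ ∧
      PID.minRedundancy P (T a) X Y = (f a : ℝ) ∧
      PID.pmRedundancy P (T a) X Y = ((g a - k : ℝ) : EReal) := by
    intro a ha
    rw [hf, hg, hk]
    exact hXY.information_values hρ₀ hρ₁ ha.1 ha.2 (hT a)
  have hI : PID.mutualInfo P X Y = ((-(1 / 2) * Real.log (1 - ρ ^ 2) : ℝ) : EReal) :=
    hXY.mutualInfo_eq hρ
  have hfl : Tendsto f (𝓝[>] 0) (𝓝 (-(1 / 2) * Real.log (1 - ρ ^ 2))) :=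
    hf ▸ PID.tendsto_gaussianInfo_fst ρ hρ hb
  have hgl : Tendsto g (𝓝[>] 0) atTop := hg ▸ PID.tendsto_gaussianInfo_snd ρ hρ hb
  have hkl : Tendsto (fun _ : ℝ => k) (𝓝[>] 0) (𝓝 k) := tendsto_const_nhds
  have h0l : Tendsto (fun _ : ℝ => (0 : ℝ)) (𝓝[>] 0) (𝓝 0) := tendsto_const_nhds
  have hfkl := hfl.add hkl
  clear hf hg
  have hmR : ∀ a ∈ Set.Ioo 0 b, (PID.dMin P (T a) X Y).R = (f a : ℝ) :=
    fun a ha => (hval a ha).2.2.2.1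
  have hmX : ∀ a ∈ Set.Ioo 0 b, (PID.dMin P (T a) X Y).UX = 0 := by
    intro a ha
    obtain ⟨e1, e2, e3, e4, e5⟩ := hval a ha
    simp only [PID.dMin, PID.decomposition, e1, e4]
    rw [← EReal.coe_sub, sub_self, EReal.coe_zero]
  have hmY : ∀ a ∈ Set.Ioo 0 b, (PID.dMin P (T a) X Y).UY = ((g a - f a : ℝ) : EReal) := by
    intro a ha
    obtain ⟨e1, e2, e3, e4, e5⟩ := hval a ha
    simp only [PID.dMin, PID.decomposition, e2, e4]
    rw [← EReal.coe_sub]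
  have hmS : ∀ a ∈ Set.Ioo 0 b, (PID.dMin P (T a) X Y).S = ⊤ := by
    intro a ha
    obtain ⟨e1, e2, e3, e4, e5⟩ := hval a ha
    simp only [PID.dMin, PID.decomposition, e1, e2, e3, e4]
    rw [← EReal.coe_sub, ← EReal.coe_sub, EReal.top_sub_coe, EReal.top_sub_coe, EReal.top_sub_coe]
  have hpR : ∀ a ∈ Set.Ioo 0 b, (PID.dPM P (T a) X Y).R = ((g a - k : ℝ) : EReal) :=
    fun a ha => (hval a ha).2.2.2.2
  have hpX : ∀ a ∈ Set.Ioo 0 b,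
      (PID.dPM P (T a) X Y).UX = ((-(g a - (f a + k)) : ℝ) : EReal) := by
    intro a ha
    obtain ⟨e1, e2, e3, e4, e5⟩ := hval a ha
    simp only [PID.dPM, PID.decomposition, e1, e5]
    rw [← EReal.coe_sub]
    congr 1
    ring
  have hpY : ∀ a ∈ Set.Ioo 0 b, (PID.dPM P (T a) X Y).UY = (k : EReal) := by
    intro a ha
    obtain ⟨e1, e2, e3, e4, e5⟩ := hval a ha
    simp only [PID.dPM, PID.decomposition, e2, e5]
    rw [← EReal.coe_sub]
    congr 1
    ring
  have hpS : ∀ a ∈ Set.Ioo 0 b, (PID.dPM P (T a) X Y).S = ⊤ := by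
    intro a ha
    obtain ⟨e1, e2, e3, e4, e5⟩ := hval a ha
    simp only [PID.dPM, PID.decomposition, e1, e2, e3, e5]
    rw [← EReal.coe_sub, ← EReal.coe_sub, EReal.top_sub_coe, EReal.top_sub_coe, EReal.top_sub_coe]
  have hYv : ∀ a ∈ Set.Ioo 0 b, PID.mutualInfo P (T a) Y = ((g a - 0 : ℝ) : EReal) := by
    intro a ha
    rw [sub_zero]
    exact (hval a ha).2.1
  have hev : ∀ᶠ a in 𝓝[>] (0 : ℝ), a ∈ Set.Ioo 0 b := Ioo_mem_nhdsGT hb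
  -- transfers a limit of real-valued functions to the extended reals
  have lim : ∀ {F : ℝ → EReal} {r : ℝ → ℝ} {x : ℝ}, (∀ a ∈ Set.Ioo 0 b, F a = (r a : EReal)) →
      Tendsto r (𝓝[>] 0) (𝓝 x) → Tendsto F (𝓝[>] 0) (𝓝 (x : EReal)) := by
    intro F r x hF hr
    refine (EReal.tendsto_coe.mpr hr).congr' ?_
    filter_upwards [hev] with a ha using (hF a ha).symm
  have quot : ∀ {F G : ℝ → EReal} {r q : ℝ → ℝ} {x : ℝ},
      (∀ a ∈ Set.Ioo 0 b, F a = (r a : EReal)) → (∀ a ∈ Set.Ioo 0 b, G a = (q a : EReal)) →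
      Tendsto (fun a => r a / q a) (𝓝[>] 0) (𝓝 x) →
      Tendsto (fun a => F a / G a) (𝓝[>] 0) (𝓝 (x : EReal)) :=
    fun hF hG h => lim (fun a ha => by rw [hF a ha, hG a ha, EReal.coe_div]) h
  have neg : ∀ {r q : ℝ → ℝ}, Tendsto (fun a => r a / q a) (𝓝[>] 0) (𝓝 1) →
      Tendsto (fun a => -r a / q a) (𝓝[>] 0) (𝓝 (-1)) := by
    intro r q h
    simpa only [neg_div] using h.neg
  refine ⟨⟨?_, ?_, hmX, ?_, hmS⟩, ⟨?_, ?_, hk ▸ hpY, hpS⟩, ⟨?_, ?_⟩, ⟨?_, ?_, ?_⟩, ?_, ?_⟩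
  · rw [hI]
    exact lim hmR hfl
  · rw [hI, Real.log_sqrt (by linarith)]
    congr 1
    ring
  · refine (EReal.tendsto_coe_nhds_top_iff.mpr (hgl.atTop_add hfl.neg)).congr' ?_
    filter_upwards [hev] with a ha
    rw [hmY a ha, sub_eq_add_neg]
  · refine (EReal.tendsto_coe_nhds_top_iff.mpr (hgl.atTop_add hkl.neg)).congr' ?_
    filter_upwards [hev] with a ha
    rw [hpR a ha, sub_eq_add_neg]
  · refine (EReal.tendsto_coe_nhds_bot_iff.mpr
      (tendsto_neg_atTop_atBot.comp (hgl.atTop_add hfkl.neg))).congr' ?_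
    filter_upwards [hev] with a ha
    rw [hpX a ha, sub_eq_add_neg]
    rfl
  · exact quot hmY hYv (PID.tendsto_sub_div_sub_one hgl hfl h0l)
  · exact quot hmR hYv (by simpa only [sub_zero] using hfl.div_atTop hgl)
  · exact quot hpX hYv (neg (PID.tendsto_sub_div_sub_one hgl hfkl h0l))
  · exact quot hpX hpR (neg (PID.tendsto_sub_div_sub_one hgl hfkl hkl))
  · exact quot hpR hYv (PID.tendsto_sub_div_sub_one hgl hkl h0l)
  · exact quot hpX hmY (neg (PID.tendsto_sub_div_sub_one hgl hfkl hfl))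
  · exact quot hmY hpR (PID.tendsto_sub_div_sub_one hgl hfl hkl)
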